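/- Let $\mathbb{K}$ be $\mathbb{R}$ or $\mathbb{C}$, let $d\ge 1$, let $\Omega\subseteq\mathbb{R}^d$ be open, and let $p\in\{0,1,2,\dots\}\cup\{\infty\}$. Let $C^p(\Omega,\mathbb{K})$ be the space of functions $\Omega\to\mathbb{K}$ of class $C^p$ (in the real sense), with the topology given by the seminorms $$\|f\|_{K,n}=\max_{|\alpha|\le n}\ \max_{x\in K}\ \left|\frac{\partial^{|\alpha|}f}{\partial x^\alpha}(x)\right|\qquad(K\subset\Omega\text{ compact},\ n\in\mathbb{N}\cup\{0\},\ n\le p).$$ Let $\omega:\Omega\to\mathbb{K}$ and $\psi:\Omega\to\Omega$ be of class $C^p$, and let $C_{\omega,\psi}:C^p(\Omega,\mathbb{K})\to C^p(\Omega,\mathbb{K})$, $C_{\omega,\psi}f=\omega\cdot(f\circ\psi)$. Suppose that $C_{\omega,\psi}$ is supercyclic, i.e. there is $g\in C^p(\Omega,\mathbb{K})$ such that $\{\lambda\, C_{\omega,\psi}^n g:\ \lambda\in\mathbb{K},\ n\ge 0\}$ is dense in $C^p(\Omega,\mathbb{K})$. Then: (a) $\omega(x)\ne 0$ for every $x\in\Omega$;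 (b) $\psi$ is injective; (c) if $p>0$, then $\det[\psi'(x)]\neq 0$ for every $x\in\Omega$; (d) if $p>0$, then $\psi$ has no periodic points, i.e. $\psi^n(x)\ne x$ for all $x\in\Omega$ and all $n\ge 1$, where $\psi^n$ is the $n$-fold composition of $\psi$ with itself. -/

import Mathlib

namespace WeightedComp

/-- `d`-dimensional Euclidean space. -/
abbrev E (d : ℕ) : Type := EuclideanSpace ℝ (Fin d)

/-- Extension by zero of a function on an open set `Ω ⊆ ℝ^d` to the whole of `ℝ^d`.  As `Ω` is open,
it has the same derivatives as the function itself at the points of `Ω`; it is used at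
no other points. -/
noncomputable def zeroExt {d : ℕ} {Ω : TopologicalSpace.Opens (E d)} {F : Type*} [Zero F]
    (f : Ω → F) : E d → F :=
  Function.extend (Subtype.val : Ω → E d) f 0

theorem zeroExt_coe {d : ℕ} {Ω : TopologicalSpace.Opens (E d)} {F : Type*} [Zero F]
    (f : Ω → F) (x : Ω) : zeroExt f (x : E d) = f x :=
  Subtype.val_injective.extend_apply f 0 x

theorem zeroExt_add {d : ℕ} {Ω : TopologicalSpace.Opens (E d)} {F : Type*} [AddCommGroup F]
    (f g : Ω → F) : zeroExt (f + g) = zeroExt f + zeroExt g := by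
  funext y
  by_cases hy : y ∈ Ω
  · have h (u : Ω → F) : zeroExt u y = u ⟨y, hy⟩ := zeroExt_coe u ⟨y, hy⟩
    simp [h]
  · have h (u : Ω → F) : zeroExt u y = 0 := by
      refine Function.extend_apply' _ _ _ ?_
      rintro ⟨a, rfl⟩
      exact hy a.2
    simp [h]

theorem zeroExt_smul {d : ℕ} {Ω : TopologicalSpace.Opens (E d)} {𝕂 : Type*} [RCLike 𝕂]
    (c : 𝕂) (f : Ω → 𝕂) : zeroExt (c • f) = c • zeroExt f := by
  funext y
  by_cases hy : y ∈ Ω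
  · have h (u : Ω → 𝕂) : zeroExt u y = u ⟨y, hy⟩ := zeroExt_coe u ⟨y, hy⟩
    simp [h]
  · have h (u : Ω → 𝕂) : zeroExt u y = 0 := by
      refine Function.extend_apply' _ _ _ ?_
      rintro ⟨a, rfl⟩
      exact hy a.2
    simp [h]

/-- `f : Ω → F` is of class `C^p` (over the reals), `p ∈ {0, 1, 2, …, ∞}`. -/
def IsCp {d : ℕ} {Ω : TopologicalSpace.Opens (E d)} {F : Type*} [NormedAddCommGroup F]
    [NormedSpace ℝ F] (p : ℕ∞) (f : Ω → F) : Prop :=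
  ContDiffOn ℝ (p : WithTop ℕ∞) (zeroExt f) (Ω : Set (E d))

/-- The vector space `C^p(Ω, 𝕂)`, as a subspace of the space of all functions `Ω → 𝕂`. -/
def cpSubmodule {d : ℕ} (p : ℕ∞) (Ω : TopologicalSpace.Opens (E d)) (𝕂 : Type*) [RCLike 𝕂] :
    Submodule 𝕂 (Ω → 𝕂) where
  carrier := {f | IsCp p f}
  zero_mem' := by
    have h : zeroExt (0 : Ω → 𝕂) = fun _ => 0 := by
      have := zeroExt_smul (0 : 𝕂) (0 : Ω → 𝕂)
      rw [zero_smul, zero_smul] at this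
      exact this
    change ContDiffOn ℝ _ _ _
    rw [h]
    exact contDiffOn_const
  add_mem' := by
    intro f g hf hg
    change ContDiffOn ℝ _ _ _
    rw [zeroExt_add]
    exact ContDiffOn.add hf hg
  smul_mem' := by
    intro c f hf
    change ContDiffOn ℝ _ _ _
    rw [zeroExt_smul]
    exact ContDiffOn.const_smul c hf

/-- The type of elements of `C^p(Ω, 𝕂)`; a separate type, so that it does not inherit the topology
of pointwise convergence. -/
def Cp {d : ℕ} (p : ℕ∞) (Ω : TopologicalSpace.Opens (E d)) (𝕂 : Type*) [RCLike 𝕂] : Type _ :=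
  ↥(cpSubmodule p Ω 𝕂)

variable {d : ℕ} {p : ℕ∞} {Ω : TopologicalSpace.Opens (E d)} {𝕂 : Type*} [RCLike 𝕂]

instance : AddCommGroup (Cp p Ω 𝕂) := inferInstanceAs (AddCommGroup ↥(cpSubmodule p Ω 𝕂))

instance : Module 𝕂 (Cp p Ω 𝕂) := inferInstanceAs (Module 𝕂 ↥(cpSubmodule p Ω 𝕂))

/-- The underlying function of an element of `C^p(Ω, 𝕂)`. -/
def Cp.toFun (f : Cp p Ω 𝕂) : Ω → 𝕂 := f.1

instance : CoeFun (Cp p Ω 𝕂) (fun _ => Ω → 𝕂) := ⟨Cp.toFun⟩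

theorem Cp.isCp (f : Cp p Ω 𝕂) : IsCp p (f : Ω → 𝕂) := f.2

theorem Cp.toFun_add (f g : Cp p Ω 𝕂) : (f + g).toFun = f.toFun + g.toFun := rfl

theorem Cp.toFun_smul (c : 𝕂) (f : Cp p Ω 𝕂) : (c • f).toFun = c • f.toFun := rfl

/-- The partial derivative `∂_{i 0} ∂_{i 1} ⋯ ∂_{i (k-1)} f (x)` of order `k`.  As `i` runs through
all `k`-tuples of coordinate indices, these run through all `∂^α f (x)` with `|α| = k`. -/
noncomputable def partialDeriv {k : ℕ} (i : Fin k → Fin d) (f : Ω → 𝕂) (x : Ω) : 𝕂 :=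
  iteratedFDeriv ℝ k (zeroExt f) (x : E d) (fun j => EuclideanSpace.single (i j) (1 : ℝ))

theorem IsCp.contDiffAt {F : Type*} [NormedAddCommGroup F] [NormedSpace ℝ F] {f : Ω → F}
    (hf : IsCp p f) (x : Ω) : ContDiffAt ℝ (p : WithTop ℕ∞) (zeroExt f) (x : E d) :=
  ContDiffOn.contDiffAt hf (Ω.isOpen.mem_nhds x.2)

theorem partialDeriv_add {k : ℕ} (hk : (k : ℕ∞) ≤ p) (i : Fin k → Fin d) (f g : Cp p Ω 𝕂)
    (x : Ω) : partialDeriv i (f + g : Cp p Ω 𝕂) x = partialDeriv i f x + partialDeriv i g x := by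
  have hk' : (k : WithTop ℕ∞) ≤ (p : WithTop ℕ∞) := by exact_mod_cast hk
  simp only [partialDeriv, Cp.toFun_add, zeroExt_add]
  rw [iteratedFDeriv_add_apply ((f.isCp.contDiffAt x).of_le hk') ((g.isCp.contDiffAt x).of_le hk')]
  rfl

theorem partialDeriv_smul {k : ℕ} (hk : (k : ℕ∞) ≤ p) (i : Fin k → Fin d) (c : 𝕂)
    (f : Cp p Ω 𝕂) (x : Ω) :
    partialDeriv i (c • f : Cp p Ω 𝕂) x = c * partialDeriv i f x := by
  have hk' : (k : WithTop ℕ∞) ≤ (p : WithTop ℕ∞) := by exact_mod_cast hk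
  simp only [partialDeriv, Cp.toFun_smul, zeroExt_smul]
  rw [iteratedFDeriv_const_smul_apply ((f.isCp.contDiffAt x).of_le hk')]
  rfl

theorem continuous_partialDeriv {k : ℕ} (hk : (k : ℕ∞) ≤ p) (i : Fin k → Fin d)
    (f : Cp p Ω 𝕂) : Continuous (partialDeriv i f) := by
  have hk' : (k : WithTop ℕ∞) ≤ (p : WithTop ℕ∞) := by exact_mod_cast hk
  rw [continuous_iff_continuousAt]
  intro x
  have h1 : ContinuousAt (iteratedFDeriv ℝ k (zeroExt (f : Ω → 𝕂))) (x : E d) :=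
    (((f.isCp.contDiffAt x).of_le hk').iteratedFDeriv_right (m := 0) (i := k)
      (by simp)).continuousAt
  have h2 : ContinuousAt (fun y : Ω => iteratedFDeriv ℝ k (zeroExt (f : Ω → 𝕂)) (y : E d)) x :=
    ContinuousAt.comp (g := iteratedFDeriv ℝ k (zeroExt (f : Ω → 𝕂))) h1
      continuous_subtype_val.continuousAt
  exact ((ContinuousMultilinearMap.apply ℝ (fun _ : Fin k => E d) 𝕂
    (fun j => EuclideanSpace.single (i j) (1 : ℝ))).continuous.continuousAt).comp h2

theorem bddAbove_partialDeriv {k : ℕ} (hk : (k : ℕ∞) ≤ p) (i : Fin k → Fin d)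
    (K : TopologicalSpace.Compacts Ω) (f : Cp p Ω 𝕂) :
    BddAbove (Set.range fun x : K => ‖partialDeriv i f (x : Ω)‖) := by
  have h := K.isCompact.bddAbove_image
    (f := fun x : Ω => ‖partialDeriv i f x‖) (continuous_partialDeriv hk i f).norm.continuousOn
  rw [Set.image_eq_range] at h
  exact h

/-- The seminorm `f ↦ sup_{x ∈ K} |∂_i f (x)|`, for a compact set `K ⊆ Ω` and a partial derivative
`∂_i` of order `k ≤ p` (it is `0` if `K` is empty). -/
noncomputable def partialSeminorm {k : ℕ} (hk : (k : ℕ∞) ≤ p) (i : Fin k → Fin d)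
    (K : TopologicalSpace.Compacts Ω) : Seminorm 𝕂 (Cp p Ω 𝕂) :=
  Seminorm.of (fun f => ⨆ x : K, ‖partialDeriv i f (x : Ω)‖)
    (by
      intro f g
      rcases isEmpty_or_nonempty K with hK | hK
      · simp [Real.iSup_of_isEmpty]
      · refine ciSup_le fun x => ?_
        rw [partialDeriv_add hk]
        exact (norm_add_le _ _).trans (add_le_add
          (le_ciSup (bddAbove_partialDeriv hk i K f) x)
          (le_ciSup (bddAbove_partialDeriv hk i K g) x)))
    (by
      intro c f
      simp only [partialDeriv_smul hk, norm_mul]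
      rw [Real.mul_iSup_of_nonneg (norm_nonneg c)])

/-- The seminorm `‖f‖_{K,n} = max_{|α| ≤ n} max_{x ∈ K} |∂^α f (x)|` on `C^p(Ω, 𝕂)`, for a compact
set `K ⊆ Ω` and a natural number `n ≤ p`. -/
noncomputable def cpSeminorm (p : ℕ∞) (Ω : TopologicalSpace.Opens (E d)) (𝕂 : Type*) [RCLike 𝕂] :
    SeminormFamily 𝕂 (Cp p Ω 𝕂) (TopologicalSpace.Compacts Ω × {n : ℕ // (n : ℕ∞) ≤ p}) :=
  fun q => (Finset.univ : Finset (Σ k : Fin (q.2.1 + 1), Fin k → Fin d)).sup fun s =>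
    partialSeminorm (k := s.1)
      (le_trans (by exact_mod_cast Nat.lt_succ_iff.mp s.1.2) q.2.2) s.2 q.1

instance : Nonempty (TopologicalSpace.Compacts Ω × {n : ℕ // (n : ℕ∞) ≤ p}) :=
  ⟨(⊥, ⟨0, by simp⟩)⟩

/-- The locally convex topology of `C^p(Ω, 𝕂)`, generated by the seminorms `‖·‖_{K,n}`. -/
noncomputable instance : TopologicalSpace (Cp p Ω 𝕂) :=
  (cpSeminorm p Ω 𝕂).moduleFilterBasis.topology

theorem withSeminorms_cpSeminorm : WithSeminorms (cpSeminorm p Ω 𝕂) := ⟨rfl⟩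

theorem IsCp.weightedComp {ω : Ω → 𝕂} {ψ : Ω → Ω} (hω : IsCp p ω)
    (hψ : IsCp p (fun x => (ψ x : E d))) {f : Ω → 𝕂} (hf : IsCp p f) :
    IsCp p (fun x => ω x * f (ψ x)) := by
  have hmaps : Set.MapsTo (zeroExt fun x => (ψ x : E d)) (Ω : Set (E d)) (Ω : Set (E d)) := by
    intro y hy
    rw [zeroExt_coe (fun x => (ψ x : E d)) ⟨y, hy⟩]
    exact (ψ ⟨y, hy⟩).2
  have h : ContDiffOn ℝ (p : WithTop ℕ∞)
      (fun y => zeroExt ω y * zeroExt f (zeroExt (fun x => (ψ x : E d)) y)) (Ω : Set (E d)) :=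
    ContDiffOn.mul hω (ContDiffOn.comp (g := zeroExt f) hf hψ hmaps)
  refine ContDiffOn.congr h ?_
  intro y hy
  have e1 := zeroExt_coe (fun x => ω x * f (ψ x)) ⟨y, hy⟩
  have e2 := zeroExt_coe ω ⟨y, hy⟩
  have e3 := zeroExt_coe (fun x => (ψ x : E d)) ⟨y, hy⟩
  have e4 := zeroExt_coe f (ψ ⟨y, hy⟩)
  simp only at e1 e2 e3 e4
  rw [e1, e2, e3, e4]

/-- The weighted composition operator `C_{ω,ψ} f = ω · (f ∘ ψ)` on `C^p(Ω, 𝕂)`, for a multiplier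
`ω ∈ C^p(Ω, 𝕂)` and a symbol `ψ ∈ C^p(Ω, Ω)`. -/
def weightedCompOp (ω : Ω → 𝕂) (ψ : Ω → Ω) (hω : IsCp p ω)
    (hψ : IsCp p (fun x => (ψ x : E d))) : Cp p Ω 𝕂 →ₗ[𝕂] Cp p Ω 𝕂 where
  toFun f := ⟨fun x => ω x * f (ψ x), hω.weightedComp hψ f.isCp⟩
  map_add' f g := Subtype.ext (funext fun x => mul_add (ω x) (f (ψ x)) (g (ψ x)))
  map_smul' c f := Subtype.ext (funext fun x => mul_left_comm (ω x) c (f (ψ x)))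

/-- A linear operator `T` is supercyclic if the projective orbit `{λ Tⁿ g : n ≥ 0, λ ∈ 𝕂}` of some
vector `g` is dense. -/
def IsSupercyclic {𝕂 X : Type*} [RCLike 𝕂] [AddCommGroup X] [Module 𝕂 X] [TopologicalSpace X]
    (T : X →ₗ[𝕂] X) : Prop :=
  ∃ g : X, Dense {y : X | ∃ (c : 𝕂) (n : ℕ), y = c • (T^[n] g)}

end WeightedComp

namespace WeightedComp

variable {d : ℕ} {p : ℕ∞} {Ω : TopologicalSpace.Opens (E d)} {𝕂 : Type*} [RCLike 𝕂]

/-! Write `T` for the operator. (a)–(c): if one of these conditions fails, some nonzero continuous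
functional `l` satisfies `l ∘ T = 0`. Then only multiples of `g` in the projective orbit meet the
open set `l ≠ 0`, which is impossible in dimension at least 2
(`IsSupercyclic.exists_apply_ne_zero`).

(d): if `ψ^n x = x`, put `U = T^n` and split the orbit of `g` into the `U`-orbits of `g, Tg, …,
T^(n-1) g`. Let `u + iv` be a complex eigenvector of `(ψ^n)'(x)` with eigenvalue `μ`. The ratio
`(∂_u f + i ∂_v f)(x) / f(x)` ignores scalars, and `U` acts on it by an affine map `z ↦ c + μ z`.
Density would make finitely many orbits of this map accumulate at every point of a real line; but
these orbits are all bounded or all locally finite (`affine_orbit_closure`), so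
`not_dense_orbits_of_fixedPoint` gives a contradiction. -/

/-! ### Point values and first derivatives as continuous functionals -/

theorem continuous_partialDeriv_apply {k : ℕ} (hk : (k : ℕ∞) ≤ p) (i : Fin k → Fin d) (x : Ω) :
    Continuous fun f : Cp p Ω 𝕂 => partialDeriv i f x := by
  let l : Cp p Ω 𝕂 →ₗ[𝕂] 𝕂 :=
    { toFun := fun f => partialDeriv i f x
      map_add' := fun f g => partialDeriv_add hk i f g x
      map_smul' := fun c f => partialDeriv_smul hk i c f x }
  refine WithSeminorms.continuous_normedSpace_rng 𝕂 withSeminorms_cpSeminorm l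
    ⟨{(⟨{x}, isCompact_singleton⟩, ⟨k, hk⟩)}, 1, ?_⟩
  intro f
  rw [Finset.sup_singleton, one_smul]
  refine le_trans ?_ (Seminorm.le_finset_sup_apply
    (Finset.mem_univ (⟨⟨k, Nat.lt_succ_self k⟩, i⟩ : Σ k' : Fin (k + 1), Fin k' → Fin d)))
  exact le_ciSup (bddAbove_partialDeriv hk i ⟨{x}, isCompact_singleton⟩ f) ⟨x, rfl⟩

/-- Evaluation at a point, as a continuous linear functional on `C^p(Ω, 𝕂)`. -/
noncomputable def evalCLM (x : Ω) : Cp p Ω 𝕂 →L[𝕂] 𝕂 where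
  toFun f := f x
  map_add' _ _ := rfl
  map_smul' _ _ := rfl
  cont := by
    have h := continuous_partialDeriv_apply (p := p) (𝕂 := 𝕂) (k := 0) (by simp) Fin.elim0 x
    simpa [partialDeriv, zeroExt_coe] using h

@[simp] theorem evalCLM_apply (x : Ω) (f : Cp p Ω 𝕂) : evalCLM x f = f x := rfl

theorem IsCp.differentiableAt {F : Type*} [NormedAddCommGroup F] [NormedSpace ℝ F] {f : Ω → F}
    (hf : IsCp p f) (hp : 0 < p) (x : Ω) : DifferentiableAt ℝ (zeroExt f) (x : E d) :=
  (hf.contDiffAt x).differentiableAt (by exact_mod_cast hp.ne')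

/-- The derivative at `x` in the direction `v`, as a continuous linear functional on
`C^p(Ω, 𝕂)`. -/
noncomputable def dirDerivCLM (hp : 0 < p) (x : Ω) (v : E d) : Cp p Ω 𝕂 →L[𝕂] 𝕂 where
  toFun f := fderiv ℝ (zeroExt (f : Ω → 𝕂)) (x : E d) v
  map_add' f g := by
    rw [Cp.toFun_add, zeroExt_add,
      fderiv_add (f.isCp.differentiableAt hp x) (g.isCp.differentiableAt hp x)]
    rfl
  map_smul' c f := by
    rw [Cp.toFun_smul, zeroExt_smul, fderiv_const_smul (f.isCp.differentiableAt hp x)]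
    rfl
  cont := by
    have h (j : Fin d) := continuous_partialDeriv_apply (p := p) (𝕂 := 𝕂) (k := 1)
      (by simpa using Order.one_le_iff_pos.mpr hp) (fun _ => j) x
    have hv (f : Cp p Ω 𝕂) : fderiv ℝ (zeroExt (f : Ω → 𝕂)) (x : E d) v =
        ∑ j, v j • partialDeriv (fun _ : Fin 1 => j) f x := by
      have e : v = ∑ j, v j • EuclideanSpace.single j (1 : ℝ) := by
        simpa using ((EuclideanSpace.basisFun (Fin d) ℝ).sum_repr v).symm
      conv_lhs => rw [e]
      simp [partialDeriv, iteratedFDeriv_one_apply]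
    simp only [hv]
    exact continuous_finsetSum _ fun j _ => (h j).const_smul _

theorem dirDerivCLM_apply (hp : 0 < p) (x : Ω) (v : E d) (f : Cp p Ω 𝕂) :
    dirDerivCLM hp x v f = fderiv ℝ (zeroExt (f : Ω → 𝕂)) (x : E d) v := rfl

theorem dirDerivCLM_lin (hp : 0 < p) (x : Ω) (a b : ℝ) (u v : E d) (f : Cp p Ω 𝕂) :
    dirDerivCLM hp x (a • u + b • v) f =
      (a : 𝕂) * dirDerivCLM hp x u f + (b : 𝕂) * dirDerivCLM hp x v f := by
  simp [dirDerivCLM_apply, RCLike.real_smul_eq_coe_mul]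

/-! ### Smooth test functions; derivatives and iterates of the operator -/

theorem zeroExt_eventuallyEq {F : Type*} [Zero F] (G : E d → F) (x : Ω) :
    zeroExt (fun y : Ω => G y) =ᶠ[nhds (x : E d)] G := by
  filter_upwards [Ω.isOpen.mem_nhds x.2] with y hy
  exact zeroExt_coe (fun y : Ω => G y) ⟨y, hy⟩

/-- The restriction to `Ω` of a smooth real function on `ℝ^d`, as an element of `C^p(Ω, 𝕂)`. -/
noncomputable def Cp.ofSmooth (F : E d → ℝ) (hF : ContDiff ℝ (⊤ : ℕ∞) F) : Cp p Ω 𝕂 :=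
  ⟨fun y => (F y : 𝕂), by
    have h : ContDiff ℝ (p : WithTop ℕ∞) (fun y => (F y : 𝕂)) :=
      (RCLike.ofRealCLM (K := 𝕂)).contDiff.comp (hF.of_le (by exact_mod_cast le_top))
    exact h.contDiffOn.congr fun y hy => zeroExt_coe (fun y : Ω => (F y : 𝕂)) ⟨y, hy⟩⟩

theorem Cp.ofSmooth_apply (F : E d → ℝ) (hF : ContDiff ℝ (⊤ : ℕ∞) F) (x : Ω) :
    (Cp.ofSmooth F hF : Cp p Ω 𝕂) x = (F x : 𝕂) := rfl

theorem dirDerivCLM_ofSmooth (hp : 0 < p) (F : E d → ℝ) (hF : ContDiff ℝ (⊤ : ℕ∞) F) (x : Ω)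
    (v : E d) : dirDerivCLM hp x v (Cp.ofSmooth F hF : Cp p Ω 𝕂) = (fderiv ℝ F x v : 𝕂) := by
  have h := (zeroExt_eventuallyEq (fun y => (F y : 𝕂)) x).fderiv_eq (𝕜 := ℝ)
  change fderiv ℝ (zeroExt fun y : Ω => (F y : 𝕂)) (x : E d) v = _
  rw [h]
  have h2 := (RCLike.ofRealCLM (K := 𝕂)).hasFDerivAt.comp (x : E d)
    ((hF.differentiable (by simp)) (x : E d)).hasFDerivAt
  have h3 : fderiv ℝ (fun y => (F y : 𝕂)) (x : E d) = _ := h2.fderiv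
  rw [h3]
  rfl

theorem dirDerivCLM_weightedCompOp (hp : 0 < p) {ω : Ω → 𝕂} {ψ : Ω → Ω} (hω : IsCp p ω)
    (hψ : IsCp p (fun x => (ψ x : E d))) (x : Ω) (v : E d) (f : Cp p Ω 𝕂) :
    dirDerivCLM hp x v (weightedCompOp ω ψ hω hψ f) =
      fderiv ℝ (zeroExt ω) (x : E d) v * f (ψ x) +
        ω x * dirDerivCLM hp (ψ x)
          (fderiv ℝ (zeroExt fun y => (ψ y : E d)) (x : E d) v) f := by
  have hev : zeroExt (weightedCompOp ω ψ hω hψ f : Ω → 𝕂) =ᶠ[nhds (x : E d)]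
      fun y => zeroExt ω y * zeroExt (f : Ω → 𝕂) (zeroExt (fun x => (ψ x : E d)) y) := by
    filter_upwards [Ω.isOpen.mem_nhds x.2] with y hy
    rw [zeroExt_coe _ ⟨y, hy⟩, zeroExt_coe ω ⟨y, hy⟩, zeroExt_coe (fun x => (ψ x : E d)) ⟨y, hy⟩,
      zeroExt_coe]
    rfl
  have e := zeroExt_coe (fun x => (ψ x : E d)) x
  have h1 := (hω.differentiableAt hp x).hasFDerivAt
  have h2 := (hψ.differentiableAt hp x).hasFDerivAt
  have h3 := (f.isCp.differentiableAt hp (ψ x)).hasFDerivAt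
  rw [← e] at h3
  have h4 := (h1.mul (h3.comp (x : E d) h2)).fderiv
  rw [dirDerivCLM_apply, hev.fderiv_eq]
  refine (congrArg (fun A : E d →L[ℝ] 𝕂 => A v) h4).trans ?_
  simp [dirDerivCLM_apply, e, zeroExt_coe]
  ring

theorem weightedCompOp_apply {ω : Ω → 𝕂} {ψ : Ω → Ω} (hω : IsCp p ω)
    (hψ : IsCp p (fun x => (ψ x : E d))) (f : Cp p Ω 𝕂) (x : Ω) :
    weightedCompOp ω ψ hω hψ f x = ω x * f (ψ x) := rfl

theorem IsCp.comp_symbol {F : Type*} [NormedAddCommGroup F] [NormedSpace ℝ F] {φ : Ω → F}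
    {ψ : Ω → Ω} (hφ : IsCp p φ) (hψ : IsCp p (fun x => (ψ x : E d))) :
    IsCp p (fun x => φ (ψ x)) := by
  have hmaps : Set.MapsTo (zeroExt fun x => (ψ x : E d)) (Ω : Set (E d)) (Ω : Set (E d)) := by
    intro y hy
    rw [zeroExt_coe (fun x => (ψ x : E d)) ⟨y, hy⟩]
    exact (ψ ⟨y, hy⟩).2
  refine ContDiffOn.congr (ContDiffOn.comp (g := zeroExt φ) hφ hψ hmaps) fun y hy => ?_
  have e1 := zeroExt_coe (fun x => φ (ψ x)) ⟨y, hy⟩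
  have e3 := zeroExt_coe (fun x => (ψ x : E d)) ⟨y, hy⟩
  have e4 := zeroExt_coe φ (ψ ⟨y, hy⟩)
  simp only at e1 e3 e4
  rw [e1, Function.comp_apply, e3, e4]

/-- The iterates of a weighted composition operator are weighted composition operators. -/
theorem exists_iterate_weightedCompOp {ω : Ω → 𝕂} {ψ : Ω → Ω} (hω : IsCp p ω)
    (hψ : IsCp p (fun x => (ψ x : E d))) (h0 : ∀ x, ω x ≠ 0) (n : ℕ) :
    ∃ (ω' : Ω → 𝕂) (hω' : IsCp p ω') (hψ' : IsCp p (fun x => (ψ^[n] x : E d))),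
      (∀ x, ω' x ≠ 0) ∧
        (weightedCompOp ω ψ hω hψ)^[n] = weightedCompOp ω' ψ^[n] hω' hψ' := by
  induction n with
  | zero =>
    refine ⟨fun _ => 1, ?_, ?_, fun _ => one_ne_zero, ?_⟩
    · have h := (Cp.ofSmooth (fun _ => 1) contDiff_const : Cp p Ω 𝕂).isCp
      have e : (Cp.ofSmooth (fun _ => 1) contDiff_const : Cp p Ω 𝕂).toFun = fun _ => 1 :=
        funext fun _ => RCLike.ofReal_one
      rwa [e] at h
    · exact contDiffOn_id.congr fun y hy => zeroExt_coe (fun x : Ω => (x : E d)) ⟨y, hy⟩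
    · funext f
      exact Subtype.ext (funext fun x => (one_mul (f x)).symm)
  | succ n ih =>
    obtain ⟨ω', hω', hψ', h0', h⟩ := ih
    refine ⟨fun x => ω x * ω' (ψ x), hω.weightedComp hψ hω', ?_,
      fun x => mul_ne_zero (h0 x) (h0' _), ?_⟩
    · exact hψ'.comp_symbol hψ
    · rw [Function.iterate_succ', h]
      funext f
      exact Subtype.ext (funext fun x => (mul_assoc (ω x) (ω' (ψ x)) (f (ψ^[n] (ψ x)))).symm)

/-! ### Functionals annihilating the range -/

/-- A nonzero continuous linear functional on a space of dimension at least `2` does not annihilate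
the range of a supercyclic operator. -/
theorem IsSupercyclic.exists_apply_ne_zero {X : Type*} [AddCommGroup X] [Module 𝕂 X]
    [TopologicalSpace X] {T : X →ₗ[𝕂] X} (hT : IsSupercyclic T) (l m : X →L[𝕂] 𝕂)
    {f h : X} (hf : l f ≠ 0) (hh : l h = 0) (hm : m h ≠ 0) : ∃ y, l (T y) ≠ 0 := by
  by_contra! H
  obtain ⟨g, hg⟩ := hT
  -- A closed condition that holds on the line through `g`; terms with `n ≥ 1` never enter `l ≠ 0`.
  have key (y : X) (hy : l y ≠ 0) : m y * l g - l y * m g = 0 := by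
    have hopen : IsOpen {y | l y ≠ 0} := isOpen_ne_fun l.continuous continuous_const
    have hcl : IsClosed {y | m y * l g - l y * m g = 0} :=
      isClosed_eq (by fun_prop) continuous_const
    refine (hcl.closure_subset_iff.mpr ?_) (hg.open_subset_closure_inter hopen hy)
    rintro _ ⟨hz, c, n, rfl⟩
    cases n with
    | zero =>
      simp only [Function.iterate_zero, id_eq, map_smul, smul_eq_mul, Set.mem_ofPred_eq]
      ring
    | succ n =>
      rw [Function.iterate_succ', Function.comp_apply] at hz
      simp [H] at hz
  have h1 := key f hf
  have h2 := key (f + h) (by simpa [hh] using hf)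
  -- Otherwise `l` vanishes on the whole projective orbit, hence at `f`.
  have hg0 : l g ≠ 0 := by
    intro h0
    have hcl : IsClosed {y | l y = 0} := isClosed_eq l.continuous continuous_const
    refine hf ((hcl.closure_subset_iff.mpr ?_) (hg f))
    rintro _ ⟨c, n, rfl⟩
    cases n with
    | zero => simp [h0]
    | succ n =>
      rw [Function.iterate_succ', Function.comp_apply]
      simp [H]
  rw [map_add, map_add, hh, add_zero] at h2
  refine mul_ne_zero hm hg0 ?_
  linear_combination h2 - h1

/-! ### Orbits of affine maps of the plane -/

/-- Only finitely many terms lie in the open ball, and they alone can accumulate inside it. -/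
theorem finite_closure_inter_ball_of_tendsto {z : ℕ → ℂ}
    (hz : Filter.Tendsto (fun q => ‖z q‖) Filter.atTop Filter.atTop) (R : ℝ) :
    (closure (Set.range z) ∩ Metric.ball 0 R).Finite := by
  have hfin : (Metric.ball (0 : ℂ) R ∩ Set.range z).Finite := by
    obtain ⟨N, hN⟩ := Filter.eventually_atTop.mp (hz.eventually_ge_atTop R)
    refine ((Set.finite_lt_nat N).image z).subset ?_
    rintro _ ⟨hq, q, rfl⟩
    refine ⟨q, Set.mem_ofPred_eq ▸ lt_of_not_ge fun h => ?_, rfl⟩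
    rw [mem_ball_zero_iff] at hq
    exact absurd (hN q h) (not_le.mpr hq)
  rw [Set.inter_comm]
  refine hfin.subset ?_
  rw [← hfin.isClosed.closure_eq]
  exact Metric.isOpen_ball.inter_closure

/-- The orbit of an affine map of the complex plane either is bounded or has only finitely many
points of its closure in each ball; which alternative holds depends on the map only. -/
theorem affine_orbit_closure (μ c : ℂ) :
    (∀ z : ℕ → ℂ, (∀ q, z (q + 1) = c + μ * z q) → Bornology.IsBounded (closure (Set.range z))) ∨
    ∀ z : ℕ → ℂ, (∀ q, z (q + 1) = c + μ * z q) →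
      ∀ R, (closure (Set.range z) ∩ Metric.ball 0 R).Finite := by
  have hconst (z : ℕ → ℂ) (w : ℂ) (h : ∀ q, z q = w) (R : ℝ) :
      (closure (Set.range z) ∩ Metric.ball 0 R).Finite := by
    have hs : (Set.range z).Subsingleton := by
      rintro _ ⟨a, rfl⟩ _ ⟨b, rfl⟩
      rw [h, h]
    rw [hs.finite.isClosed.closure_eq]
    exact hs.finite.inter_of_left _
  by_cases h1 : μ = 1
  · right
    intro z hz R
    have hq (q : ℕ) : z q = z 0 + q * c := by
      induction q with
      | zero => simp
      | succ q ih => rw [hz, ih, h1]; push_cast; ring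
    by_cases hc : c = 0
    · exact hconst z (z 0) (fun q => by simp [hq q, hc]) R
    refine finite_closure_inter_ball_of_tendsto ?_ R
    refine Filter.tendsto_atTop_mono (f := fun q : ℕ => q * ‖c‖ + -‖z 0‖) (fun q => ?_)
      (Filter.tendsto_atTop_add_const_right _ _
        (tendsto_natCast_atTop_atTop.atTop_mul_const (norm_pos_iff.mpr hc)))
    have := norm_sub_norm_le (q * c) (-z 0)
    rw [norm_neg, sub_neg_eq_add, add_comm _ (z 0), ← hq, norm_mul, Complex.norm_natCast] at this
    linarith
  have hμ : 1 - μ ≠ 0 := sub_ne_zero.mpr (Ne.symm h1)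
  -- The fixed point of the map; about it the map is multiplication by `μ`.
  obtain ⟨w, hw⟩ : ∃ w, w = c + μ * w := ⟨c / (1 - μ), by field_simp; ring⟩
  have hq (z : ℕ → ℂ) (hz : ∀ q, z (q + 1) = c + μ * z q) (q : ℕ) :
      z q = w + μ ^ q * (z 0 - w) := by
    induction q with
    | zero => simp
    | succ q ih => rw [hz, ih]; linear_combination (-1 : ℂ) * hw
  rcases le_or_gt ‖μ‖ 1 with hle | hlt
  · left
    intro z hz
    refine ((Metric.isBounded_closedBall (x := w) (r := ‖z 0 - w‖)).subset ?_).closure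
    rintro _ ⟨q, rfl⟩
    rw [mem_closedBall_iff_norm, hq z hz q, add_sub_cancel_left, norm_mul, norm_pow]
    exact mul_le_of_le_one_left (norm_nonneg _) (pow_le_one₀ (norm_nonneg _) hle)
  · right
    intro z hz R
    by_cases h0 : z 0 = w
    · exact hconst z w (fun q => by simp [hq z hz q, h0]) R
    refine finite_closure_inter_ball_of_tendsto ?_ R
    refine Filter.tendsto_atTop_mono (f := fun q : ℕ => ‖μ‖ ^ q * ‖z 0 - w‖ + -‖w‖) (fun q => ?_)
      (Filter.tendsto_atTop_add_const_right _ _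
        ((tendsto_pow_atTop_atTop_of_one_lt hlt).atTop_mul_const
          (norm_pos_iff.mpr (sub_ne_zero.mpr h0))))
    have := norm_sub_norm_le (μ ^ q * (z 0 - w)) (-w)
    rw [norm_neg, sub_neg_eq_add, add_comm _ w, ← hq z hz, norm_mul, norm_pow] at this
    linarith

/-- The union of finitely many orbits of an affine map of the complex plane is not dense in any
real line through the origin. -/
theorem exists_smul_notMem_closure_affine_orbits {ι : Type*} [Finite ι] (μ c : ℂ)
    (z : ι → ℕ → ℂ) (hz : ∀ r q, z r (q + 1) = c + μ * z r q) {ζ : ℂ} (hζ : ζ ≠ 0) :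
    ∃ t : ℝ, (t : ℂ) * ζ ∉ closure (⋃ r, Set.range (z r)) := by
  by_contra! H
  simp only [closure_iUnion_of_finite] at H
  -- The alternative is common to all the orbits, so it passes to their finite union; a line is
  -- neither bounded nor locally finite.
  rcases affine_orbit_closure μ c with h | h
  · have hb : Bornology.IsBounded (⋃ r, closure (Set.range (z r))) :=
      Bornology.isBounded_iUnion.mpr fun r => h (z r) (hz r)
    obtain ⟨C, hC⟩ := hb.exists_norm_le
    have := hC _ (H ((|C| + 1) / ‖ζ‖))
    rw [norm_mul, Complex.norm_real, norm_div, norm_norm, div_mul_cancel₀ _ (norm_ne_zero_iff.mpr hζ),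
      Real.norm_of_nonneg (by positivity)] at this
    linarith [le_abs_self C]
  · have hf : ((⋃ r, closure (Set.range (z r))) ∩ Metric.ball 0 1).Finite := by
      rw [Set.iUnion_inter]
      exact Set.finite_iUnion fun r => h (z r) (hz r) 1
    have hn : 0 < ‖ζ‖ := norm_pos_iff.mpr hζ
    have hinj : Function.Injective fun t : ℝ => (t : ℂ) * ζ := fun a b hab => by
      simpa [hζ] using hab
    refine (Set.Ioo_infinite (show (0 : ℝ) < 1 / ‖ζ‖ by positivity))
      ((hf.preimage hinj.injOn).subset fun t ht => ⟨H t, ?_⟩)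
    rw [mem_ball_zero_iff, norm_mul, Complex.norm_real, Real.norm_of_nonneg ht.1.le]
    exact (lt_div_iff₀ hn).mp ht.2

/-! ### Complexification and the fixed-point obstruction -/

/-- A real endomorphism has a complex eigenvector `u + i v`. -/
theorem exists_complex_eigenvector (hd : 1 ≤ d) (B : E d →L[ℝ] E d) :
    ∃ (u v : E d) (a b : ℝ), (u ≠ 0 ∨ v ≠ 0) ∧ B u = a • u + (-b) • v ∧ B v = b • u + a • v := by
  have : Nonempty (Fin d) := ⟨⟨0, hd⟩⟩
  let b := (EuclideanSpace.basisFun (Fin d) ℝ).toBasis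
  let M := LinearMap.toMatrix b b B.toLinearMap
  obtain ⟨μ, hμ⟩ := Module.End.exists_eigenvalue (Matrix.toLin' (M.map Complex.ofReal))
  obtain ⟨w, hw⟩ := hμ.exists_hasEigenvector
  have hB (x : E d) (i : Fin d) : B x i = ∑ j, M i j * x j := by
    have := congrFun (LinearMap.toMatrix_mulVec_repr b b B.toLinearMap x) i
    simpa [b, Matrix.mulVec, dotProduct] using this.symm
  have hi (i : Fin d) : ∑ j, (M i j : ℂ) * w j = μ * w i := by
    simpa [Matrix.mulVec, dotProduct] using congrFun hw.apply_eq_smul i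
  -- Real and imaginary parts of `M w = μ w`, the matrix `M` being real.
  refine ⟨WithLp.toLp 2 fun j => (w j).re, WithLp.toLp 2 fun j => (w j).im, μ.re, μ.im, ?_, ?_, ?_⟩
  · by_contra! h
    refine hw.2 (funext fun j => Complex.ext ?_ ?_)
    · exact congrArg (fun x : E d => x j) h.1
    · exact congrArg (fun x : E d => x j) h.2
  · ext i
    have := congrArg Complex.re (hi i)
    simp only [Complex.re_sum, Complex.mul_re, Complex.ofReal_re, Complex.ofReal_im, zero_mul,
      sub_zero] at this
    simp [hB, this, sub_eq_add_neg]
  · ext i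
    have := congrArg Complex.im (hi i)
    simp only [Complex.im_sum, Complex.mul_im, Complex.ofReal_re, Complex.ofReal_im, zero_mul,
      add_zero] at this
    simp [hB, this, add_comm]

/-- The embedding of `ℝ` or `ℂ` into `ℂ`. -/
noncomputable def toComplex (𝕂 : Type*) [RCLike 𝕂] : 𝕂 →+* ℂ where
  toFun z := ⟨RCLike.re z, RCLike.im z⟩
  map_one' := by simp [Complex.ext_iff]
  map_mul' z w := by simp [Complex.ext_iff]
  map_zero' := by simp [Complex.ext_iff]
  map_add' z w := by simp [Complex.ext_iff]

theorem toComplex_ofReal (t : ℝ) : toComplex 𝕂 (t : 𝕂) = t := by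
  simp [toComplex, Complex.ext_iff]

theorem continuous_toComplex : Continuous (toComplex 𝕂) := by
  have h : (toComplex 𝕂 : 𝕂 → ℂ) = fun z => (RCLike.re z : ℂ) + (RCLike.im z : ℂ) * Complex.I := by
    funext z
    simp [toComplex, Complex.ext_iff]
  rw [h]
  fun_prop

/-- These affine test functions have value `s` and gradient `t • u` at `x`. -/
theorem fderiv_inner_sub (x u y v : E d) (s t : ℝ) :
    fderiv ℝ (fun y => s + t * inner ℝ u (y - x)) y v = t * inner ℝ u v := by
  have h : HasFDerivAt (fun y => s + t * inner ℝ u (y - x)) (t • innerSL ℝ u) y := by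
    have h1 := (innerSL ℝ u).hasFDerivAt.comp y ((hasFDerivAt_id y).sub_const x)
    exact (h1.const_mul t).const_add s
  rw [h.fderiv]
  rfl

theorem contDiff_inner_sub (x u : E d) (s t : ℝ) :
    ContDiff ℝ (⊤ : ℕ∞) (fun y => s + t * inner ℝ u (y - x)) :=
  contDiff_const.add (contDiff_const.mul (contDiff_const.inner ℝ (contDiff_id.sub contDiff_const)))

/-- If `ψ` has a fixed point at which `ω` does not vanish, then the projective orbits of finitely
many vectors under `C_{ω,ψ}` are not dense in `C^p(Ω, 𝕂)`, `p > 0`. -/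
theorem not_dense_orbits_of_fixedPoint (hd : 1 ≤ d) (hp : 0 < p) {ω : Ω → 𝕂} {ψ : Ω → Ω}
    (hω : IsCp p ω) (hψ : IsCp p (fun x => (ψ x : E d))) {x : Ω} (hx : ψ x = x) (h0 : ω x ≠ 0)
    {ι : Type*} [Finite ι] (g : ι → Cp p Ω 𝕂) :
    ¬ Dense {y | ∃ (c : 𝕂) (r : ι) (q : ℕ), y = c • (weightedCompOp ω ψ hω hψ)^[q] (g r)} := by
  intro hdense
  set U := weightedCompOp ω ψ hω hψ
  obtain ⟨u, v, a, b, huv, hBu, hBv⟩ :=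
    exists_complex_eigenvector hd (fderiv ℝ (zeroExt fun y => (ψ y : E d)) (x : E d))
  let e : Cp p Ω 𝕂 → ℂ := fun f => toComplex 𝕂 (f x)
  -- The derivative at `x` along the complex eigenvector `u + iv`.
  let φ : Cp p Ω 𝕂 → ℂ := fun f =>
    toComplex 𝕂 (dirDerivCLM hp x u f) + toComplex 𝕂 (dirDerivCLM hp x v f) * Complex.I
  have he : Continuous e := continuous_toComplex.comp (evalCLM x).continuous
  have hφ : Continuous φ :=
    (continuous_toComplex.comp (dirDerivCLM hp x u).continuous).add
      ((continuous_toComplex.comp (dirDerivCLM hp x v).continuous).mul continuous_const)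
  let α := toComplex 𝕂 (ω x)
  have hα : α ≠ 0 := (map_ne_zero _).mpr h0
  let β := toComplex 𝕂 (fderiv ℝ (zeroExt ω) (x : E d) u) +
    toComplex 𝕂 (fderiv ℝ (zeroExt ω) (x : E d) v) * Complex.I
  let μ : ℂ := a + b * Complex.I
  have heU (f) : e (U f) = α * e f := by
    simp only [e, U, weightedCompOp_apply, hx, map_mul, α]
  have hφU (f) : φ (U f) = β * e f + α * (μ * φ f) := by
    simp only [φ, U, dirDerivCLM_weightedCompOp, hBu, hBv, hx, dirDerivCLM_lin, map_add, map_mul,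
      toComplex_ofReal, e, α, β, μ, Complex.ofReal_neg]
    linear_combination (-α * b * toComplex 𝕂 (dirDerivCLM hp x v f)) * Complex.I_sq
  have hes (c : 𝕂) (f) : e (c • f) = toComplex 𝕂 c * e f := map_mul (toComplex 𝕂) c (f x)
  have hφs (c : 𝕂) (f) : φ (c • f) = toComplex 𝕂 c * φ f := by
    simp only [φ, map_smul, smul_eq_mul, map_mul]
    ring
  have heq (q : ℕ) (f) : e (U^[q] f) = α ^ q * e f := by
    induction q with
    | zero => simp
    | succ q ih => rw [Function.iterate_succ', Function.comp_apply, heU, ih]; ring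
  obtain ⟨u₀, hu₀⟩ : ∃ u₀ : E d, (inner ℝ u₀ u : ℂ) + (inner ℝ u₀ v : ℂ) * Complex.I ≠ 0 := by
    have hre (s t : ℝ) : ((s : ℂ) + (t : ℂ) * Complex.I).re = s := by simp
    have him (s t : ℝ) : ((s : ℂ) + (t : ℂ) * Complex.I).im = t := by simp
    rcases huv with h | h
    · exact ⟨u, fun H => h (inner_self_eq_zero.mp ((hre _ _).symm.trans (congrArg Complex.re H)))⟩
    · exact ⟨v, fun H => h (inner_self_eq_zero.mp ((him _ _).symm.trans (congrArg Complex.im H)))⟩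
  -- Since `e` is only multiplied by `α` at each step, the other orbits never enter `e ≠ 0`.
  let z : {r // e (g r) ≠ 0} → ℕ → ℂ := fun r q => φ (U^[q] (g r)) / e (U^[q] (g r))
  have hz (r q) : z r (q + 1) = β / α + μ * z r q := by
    have h : e (U^[q] (g r)) ≠ 0 := by
      rw [heq]
      exact mul_ne_zero (pow_ne_zero q hα) r.2
    simp only [z, Function.iterate_succ', Function.comp_apply, heU, hφU]
    field_simp
  obtain ⟨t, ht⟩ := exists_smul_notMem_closure_affine_orbits μ (β / α) z hz hu₀
  apply ht
  let f : Cp p Ω 𝕂 := Cp.ofSmooth _ (contDiff_inner_sub (x : E d) u₀ 1 t)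
  have hef : e f = 1 := by
    simp [e, f, Cp.ofSmooth_apply]
  have hφf : φ f = t * ((inner ℝ u₀ u : ℂ) + (inner ℝ u₀ v : ℂ) * Complex.I) := by
    simp only [φ, f, dirDerivCLM_ofSmooth, fderiv_inner_sub, toComplex_ofReal, Complex.ofReal_mul]
    ring
  -- The ratio at `f` is `t * ζ`, where `ζ` is the number in `hu₀`; density carries it into the
  -- closure of the ratios along the orbits.
  have hcont : ContinuousAt (fun f => φ f / e f) f :=
    hφ.continuousAt.div he.continuousAt (by simp [hef])
  have hcl := mem_closure_image hcont (hdense.open_subset_closure_inter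
    (isOpen_ne_fun he continuous_const) (show e f ≠ 0 by simp [hef]))
  simp only [hef, hφf, div_one] at hcl
  refine closure_mono ?_ hcl
  rintro _ ⟨_, ⟨hy, c, r, q, rfl⟩, rfl⟩
  have hy' : e (c • U^[q] (g r)) ≠ 0 := hy
  rw [hes, heq] at hy'
  refine Set.mem_iUnion.mpr ⟨⟨r, right_ne_zero_of_mul (right_ne_zero_of_mul hy')⟩, q, ?_⟩
  simp only [z, hes, hφs]
  exact (mul_div_mul_left _ _ (left_ne_zero_of_mul hy')).symm

/-- Division with remainder, `k = n * (k / n) + k % n`, splits the orbit into `n` orbits of the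
`n`-th iterate. -/
theorem IsSupercyclic.iterate_symbol_ne (hd : 1 ≤ d) (hp : 0 < p) {ω : Ω → 𝕂} {ψ : Ω → Ω}
    {hω : IsCp p ω} {hψ : IsCp p (fun x => (ψ x : E d))}
    (hsc : IsSupercyclic (weightedCompOp ω ψ hω hψ)) (h0 : ∀ x, ω x ≠ 0) (x : Ω) {n : ℕ}
    (hn : 0 < n) : ψ^[n] x ≠ x := by
  intro hx
  obtain ⟨g, hg⟩ := hsc
  obtain ⟨ω', hω', hψ', h0', hiter⟩ := exists_iterate_weightedCompOp hω hψ h0 n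
  refine not_dense_orbits_of_fixedPoint hd hp hω' hψ' hx (h0' x)
    (fun r : Fin n => (weightedCompOp ω ψ hω hψ)^[r] g) (hg.mono ?_)
  rintro _ ⟨c, k, rfl⟩
  refine ⟨c, ⟨k % n, Nat.mod_lt k hn⟩, k / n, ?_⟩
  rw [← hiter, ← Function.iterate_mul, ← Function.iterate_add_apply, Nat.div_add_mod]

/-! ### Nonvanishing weight, injectivity and nonzero Jacobian -/

theorem exists_ne_notMem (hd : 1 ≤ d) (x y : Ω) : ∃ w : Ω, w ≠ x ∧ w ≠ y := by
  have : Nonempty (Fin d) := ⟨⟨0, hd⟩⟩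
  have hinf : (Ω : Set (E d)).Infinite := infinite_of_mem_nhds (x : E d) (Ω.isOpen.mem_nhds x.2)
  obtain ⟨w, hw, hw'⟩ := hinf.exists_notMem_finite (Set.toFinite {(x : E d), (y : E d)})
  simp only [Set.mem_insert_iff, Set.mem_singleton_iff, not_or] at hw'
  exact ⟨⟨w, hw⟩, fun h => hw'.1 (congrArg Subtype.val h), fun h => hw'.2 (congrArg Subtype.val h)⟩

/-- Supplies `h` in the kernel of `l`: it vanishes at `x` and `y`, with zero derivative at `x` when
`y = x`, but not at a third point `w`. -/
theorem contDiff_normSq_mul_normSq (x y : E d) :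
    ContDiff ℝ (⊤ : ℕ∞) (fun w => ‖w - x‖ ^ 2 * ‖w - y‖ ^ 2) := by
  have h (x : E d) : ContDiff ℝ (⊤ : ℕ∞) (fun w => ‖w - x‖ ^ 2) :=
    (contDiff_id.sub contDiff_const).norm_sq ℝ
  exact (h x).mul (h y)

theorem fderiv_normSq_mul_normSq (x : E d) :
    fderiv ℝ (fun w => ‖w - x‖ ^ 2 * ‖w - x‖ ^ 2) x = 0 := by
  have h := ((hasFDerivAt_id x).sub_const x).norm_sq
  exact (h.mul h).fderiv.trans (by simp)

theorem IsSupercyclic.weight_ne_zero (hd : 1 ≤ d) {ω : Ω → 𝕂} {ψ : Ω → Ω}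
    {hω : IsCp p ω} {hψ : IsCp p (fun x => (ψ x : E d))}
    (hsc : IsSupercyclic (weightedCompOp ω ψ hω hψ)) (x : Ω) : ω x ≠ 0 := by
  intro h0
  obtain ⟨w, hw, -⟩ := exists_ne_notMem hd x x
  have hw' : (w : E d) - x ≠ 0 := sub_ne_zero.mpr fun h => hw (Subtype.ext h)
  obtain ⟨y, hy⟩ := hsc.exists_apply_ne_zero (evalCLM x) (evalCLM w)
    (f := Cp.ofSmooth (fun _ => 1) contDiff_const)
    (h := Cp.ofSmooth _ (contDiff_normSq_mul_normSq (x : E d) x))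
    (by simp [Cp.ofSmooth_apply]) (by simp [Cp.ofSmooth_apply])
    (by simpa [Cp.ofSmooth_apply] using hw')
  exact hy (by simp [weightedCompOp_apply, h0])

theorem IsSupercyclic.symbol_injective (hd : 1 ≤ d) {ω : Ω → 𝕂} {ψ : Ω → Ω}
    {hω : IsCp p ω} {hψ : IsCp p (fun x => (ψ x : E d))}
    (hsc : IsSupercyclic (weightedCompOp ω ψ hω hψ)) : Function.Injective ψ := by
  intro x y hxy
  by_contra hne
  obtain ⟨w, hwx, hwy⟩ := exists_ne_notMem hd x y
  have hwx' : (w : E d) - x ≠ 0 := sub_ne_zero.mpr fun h => hwx (Subtype.ext h)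
  have hwy' : (w : E d) - y ≠ 0 := sub_ne_zero.mpr fun h => hwy (Subtype.ext h)
  have hne' : (y : E d) - x ≠ 0 := sub_ne_zero.mpr fun h => hne (Subtype.ext h.symm)
  have h0 := hsc.weight_ne_zero hd x
  -- Values of `T f` at `x` and `y` are `ω x` and `ω y` times the same number, so this combination
  -- kills the range.
  let l : Cp p Ω 𝕂 →L[𝕂] 𝕂 :=
    { toLinearMap := ω y • (evalCLM x).toLinearMap - ω x • (evalCLM y).toLinearMap
      cont := ((evalCLM x).continuous.const_smul (ω y)).sub
        ((evalCLM y).continuous.const_smul (ω x)) }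
  have hl (f) : l f = ω y * f x - ω x * f y := rfl
  obtain ⟨f, hf⟩ := hsc.exists_apply_ne_zero l (evalCLM w)
    (f := Cp.ofSmooth _ (contDiff_inner_sub (x : E d) (y - x) 0 1))
    (h := Cp.ofSmooth _ (contDiff_normSq_mul_normSq (x : E d) y))
    (by simpa [hl, Cp.ofSmooth_apply, h0] using hne') (by simp [hl, Cp.ofSmooth_apply])
    (by simpa [Cp.ofSmooth_apply] using ⟨hwx', hwy'⟩)
  refine hf ?_
  rw [hl, weightedCompOp_apply, weightedCompOp_apply, hxy]
  ring

theorem IsSupercyclic.det_fderiv_symbol_ne_zero (hd : 1 ≤ d) (hp : 0 < p) {ω : Ω → 𝕂} {ψ : Ω → Ω}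
    {hω : IsCp p ω} {hψ : IsCp p (fun x => (ψ x : E d))}
    (hsc : IsSupercyclic (weightedCompOp ω ψ hω hψ)) (x : Ω) :
    (fderiv ℝ (zeroExt fun y => (ψ y : E d)) (x : E d)).det ≠ 0 := by
  intro hdet
  obtain ⟨v, hv, hv0⟩ := Submodule.exists_mem_ne_zero_of_ne_bot
    (LinearMap.bot_lt_ker_of_det_eq_zero hdet).ne'
  have hv' : fderiv ℝ (zeroExt fun y => (ψ y : E d)) (x : E d) v = 0 := hv
  obtain ⟨w, hw, -⟩ := exists_ne_notMem hd x x
  have hw' : (w : E d) - x ≠ 0 := sub_ne_zero.mpr fun h => hw (Subtype.ext h)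
  have h0 := hsc.weight_ne_zero hd x
  -- As `ψ'(x) v = 0`, the derivative of `T f` along `v` is `∂_v ω(x) * f (ψ x)`, proportional to
  -- its value `ω x * f (ψ x)`.
  let l : Cp p Ω 𝕂 →L[𝕂] 𝕂 :=
    { toLinearMap := ω x • (dirDerivCLM hp x v).toLinearMap -
        fderiv ℝ (zeroExt ω) (x : E d) v • (evalCLM x).toLinearMap
      cont := ((dirDerivCLM hp x v).continuous.const_smul (ω x)).sub
        ((evalCLM x).continuous.const_smul _) }
  have hl (f) : l f = ω x * dirDerivCLM hp x v f - fderiv ℝ (zeroExt ω) (x : E d) v * f x := rfl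
  obtain ⟨f, hf⟩ := hsc.exists_apply_ne_zero l (evalCLM w)
    (f := Cp.ofSmooth _ (contDiff_inner_sub (x : E d) v 0 1))
    (h := Cp.ofSmooth _ (contDiff_normSq_mul_normSq (x : E d) x))
    (by
      rw [hl, dirDerivCLM_ofSmooth, fderiv_inner_sub]
      simp [Cp.ofSmooth_apply, h0, hv0])
    (by
      rw [hl, dirDerivCLM_ofSmooth, fderiv_normSq_mul_normSq]
      simp [Cp.ofSmooth_apply])
    (by simpa [Cp.ofSmooth_apply] using hw')
  refine hf ?_
  rw [hl, weightedCompOp_apply, dirDerivCLM_weightedCompOp, hv', dirDerivCLM_apply]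
  simp only [map_zero]
  ring

end WeightedComp

theorem mainTheorem2 {𝕂 : Type*} [RCLike 𝕂] {d : ℕ} (hd : 1 ≤ d)
    (Ω : TopologicalSpace.Opens (EuclideanSpace ℝ (Fin d))) (p : ℕ∞)
    (ω : Ω → 𝕂) (ψ : Ω → Ω)
    (hω : WeightedComp.IsCp p ω)
    (hψ : WeightedComp.IsCp p (fun x => (ψ x : EuclideanSpace ℝ (Fin d))))
    (hsc : WeightedComp.IsSupercyclic (WeightedComp.weightedCompOp ω ψ hω hψ)) :
    (∀ x : Ω, ω x ≠ 0) ∧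
    Function.Injective ψ ∧
    (0 < p → ∀ x : Ω,
      (fderiv ℝ (WeightedComp.zeroExt fun y : Ω => (ψ y : EuclideanSpace ℝ (Fin d)))
        (x : EuclideanSpace ℝ (Fin d))).det ≠ 0) ∧
    (0 < p → ∀ x : Ω, ∀ n : ℕ, 0 < n → ψ^[n] x ≠ x) :=
  ⟨hsc.weight_ne_zero hd, hsc.symbol_injective hd,
    fun hp x => hsc.det_fderiv_symbol_ne_zero hd hp x,
    fun hp x _ hn => hsc.iterate_symbol_ne hd hp (hsc.weight_ne_zero hd) x hn⟩
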